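/- Let $N\ge 2$ and let $\Omega\subset\mathbb R^N$ be a bounded domain with Lipschitz boundary. For a function $p$ on $\Omega$ write $p_-=\inf_\Omega p$ and $p_+=\sup_\Omega p$. Let $\mathscr C$ be the set of all $p\in C(\overline\Omega)$ such that $1<p_-\le p_+<N$ and such that, for some $L>0$, $|p(x)-p(y)|\le -L/\log|x-y|$ for all $x,y\in\Omega$ with $0<|x-y|\le 1/2$. For $p\in\mathscr C$ put $\varrho_{p(x)}(u)=\int_\Omega|u(x)|^{p(x)}\,dx$, let $L^{p(x)}(\Omega)$ be the space of measurable functions $u$ with $\varrho_{p(x)}(u)<\infty$, with the Luxemburg norm $\|u\|_{p(x)}=\inf\{\gamma>0:\varrho_{p(x)}(u/\gamma)\le 1\}$ (and likewise for vector-valued functions), and let $W^{1,p(x)}_0(\Omega)$ be the closure of $C^\infty_c(\Omega)$ in $W^{1,p(x)}(\Omega)=\{u\in L^{p(x)}(\Omega):\nabla u\in L^{p(x)}(\Omega)\}$, where $\nabla u$ is the distributional gradient, with respect to the norm $\|u\|_{p(x)}+\|\nabla u\|_{p(x)}$. For $u\in L^1(\Omega)$ define $$\mathscr E_{p(x)}(u)=\begin{cases}\|\nabla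 u\|_{p(x)}&\text{if }u\in W^{1,p(x)}_0(\Omega),\\+\infty&\text{otherwise,}\end{cases}\qquad g_{p(x)}(u)=\begin{cases}\|u\|_{p(x)}&\text{if }u\in L^{p(x)}(\Omega),\\0&\text{otherwise.}\end{cases}$$ **Theorem.** Let $p\in\mathscr C$ and $(p_h)_{h\in\mathbb N}\subset\mathscr C$ with $p_h\to p$ pointwise in $\Omega$, and suppose that for some $\bar h\in\mathbb N$ $$p_I:=\inf_{h\ge\bar h}(p_h)_->1\qquad\text{and}\qquad p_S:=\sup_{h\ge\bar h}(p_h)_+<p_I^*:=\frac{Np_I}{N-p_I}.$$ Then for every subsequence $(p_{h_n})$ of $(p_h)$ and every sequence $(u_n)\subset L^1(\Omega)$ with $\sup_{n\in\mathbb N}\mathscr E_{p_{h_n}(x)}(u_n)<\infty$ there exist a subsequence $(u_{n_j})$ and a function $u\in L^1(\Omega)\cap L^{p(x)}(\Omega)$ such that, as $j\to\infty$, $$u_{n_j}\to u\ \text{ in }L^1(\Omega)\qquad\text{and}\qquad g_{p_{h_{n_j}}(x)}(u_{n_j})\to g_{p(x)}(u),$$ that is, $\|u_{n_j}\|_{p_{h_{n_j}}(x)}\to\|u\|_{p(x)}$.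 -/

import Mathlib

open MeasureTheory Filter Topology Set

noncomputable section

namespace VarExp

/-- The Euclidean space `ℝ^N`. -/
abbrev Eu (N : ℕ) : Type := EuclideanSpace ℝ (Fin N)

/-- Lipschitz boundary: near each boundary point, `Ω` is the strict epigraph, in some unit
direction `ν`, of a Lipschitz function `φ` of the component orthogonal to `ν`. -/
def HasLipschitzBoundary {N : ℕ} (Ω : Set (Eu N)) : Prop :=
  ∀ x₀ ∈ frontier Ω, ∃ r : ℝ, 0 < r ∧ ∃ ν : Eu N, ‖ν‖ = 1 ∧
    ∃ (K : NNReal) (φ : Eu N → ℝ), LipschitzWith K φ ∧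
      ∀ y ∈ Metric.ball x₀ r, (y ∈ Ω ↔ φ (y - inner ℝ ν y • ν) < inner ℝ ν y)

/-- A bounded domain (nonempty, connected, open set) with Lipschitz boundary. -/
structure IsBoundedLipschitzDomain {N : ℕ} (Ω : Set (Eu N)) : Prop where
  isOpen : IsOpen Ω
  isConnected : IsConnected Ω
  isBounded : Bornology.IsBounded Ω
  lipschitz : HasLipschitzBoundary Ω

/-- `p₋ = inf_Ω p`. -/
def expInf {N : ℕ} (Ω : Set (Eu N)) (p : Eu N → ℝ) : ℝ := sInf (p '' Ω)

/-- `p₊ = sup_Ω p`. -/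
def expSup {N : ℕ} (Ω : Set (Eu N)) (p : Eu N → ℝ) : ℝ := sSup (p '' Ω)

/-- The class of admissible exponents: continuous on the closure of `Ω`, `1 < p₋ ≤ p₊ < N`,
and log-Hölder continuous in `Ω`. Only the values on the closure of `Ω` matter. -/
structure Admissible {N : ℕ} (Ω : Set (Eu N)) (p : Eu N → ℝ) : Prop where
  continuousOn : ContinuousOn p (closure Ω)
  one_lt : 1 < expInf Ω p
  lt_dim : expSup Ω p < N
  logHolder : ∃ L : ℝ, 0 < L ∧ ∀ x ∈ Ω, ∀ y ∈ Ω, 0 < ‖x - y‖ → ‖x - y‖ ≤ 1 / 2 →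
    |p x - p y| ≤ -(L / Real.log ‖x - y‖)

/-- The `p(x)`-modular `∫_Ω |f|^{p(x)} dx`, for scalar or vector valued `f`. -/
def modular {N : ℕ} {F : Type*} [NormedAddCommGroup F]
    (Ω : Set (Eu N)) (p : Eu N → ℝ) (f : Eu N → F) : ENNReal :=
  ∫⁻ x in Ω, ‖f x‖ₑ ^ p x

/-- Membership in the variable exponent Lebesgue space `L^{p(x)}(Ω)`. -/
def MemLpVar {N : ℕ} {F : Type*} [NormedAddCommGroup F]
    (Ω : Set (Eu N)) (p : Eu N → ℝ) (f : Eu N → F) : Prop :=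
  AEStronglyMeasurable f (volume.restrict Ω) ∧ modular Ω p f < ⊤

/-- The Luxemburg norm `inf {γ > 0 : ϱ_{p(x)}(f / γ) ≤ 1}`. -/
def luxNorm {N : ℕ} {F : Type*} [NormedAddCommGroup F] [NormedSpace ℝ F]
    (Ω : Set (Eu N)) (p : Eu N → ℝ) (f : Eu N → F) : ℝ :=
  sInf {γ : ℝ | 0 < γ ∧ modular Ω p (fun x => γ⁻¹ • f x) ≤ 1}

/-- `φ ∈ C_c^∞(Ω)`. -/
def IsTest {N : ℕ} (Ω : Set (Eu N)) (φ : Eu N → ℝ) : Prop :=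
  ContDiff ℝ (⊤ : ℕ∞) φ ∧ HasCompactSupport φ ∧ tsupport φ ⊆ Ω

/-- `G` is a distributional gradient of `u` in `Ω`. -/
def IsWeakGrad {N : ℕ} (Ω : Set (Eu N)) (u : Eu N → ℝ) (G : Eu N → Eu N) : Prop :=
  LocallyIntegrableOn u Ω ∧ LocallyIntegrableOn G Ω ∧
    ∀ φ : Eu N → ℝ, IsTest Ω φ → ∀ i : Fin N,
      ∫ x in Ω, u x * gradient φ x i = -∫ x in Ω, G x i * φ x

open Classical in
/-- The distributional gradient of `u` in `Ω` (unique up to null sets of `Ω`);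
`0` if `u` has no locally integrable distributional gradient. -/
def weakGrad {N : ℕ} (Ω : Set (Eu N)) (u : Eu N → ℝ) : Eu N → Eu N :=
  if h : ∃ G, IsWeakGrad Ω u G then h.choose else 0

/-- Membership in `W^{1,p(x)}(Ω)`. -/
def MemW1 {N : ℕ} (Ω : Set (Eu N)) (p : Eu N → ℝ) (u : Eu N → ℝ) : Prop :=
  MemLpVar Ω p u ∧ (∃ G, IsWeakGrad Ω u G) ∧ MemLpVar Ω p (weakGrad Ω u)

/-- Membership in `W_0^{1,p(x)}(Ω)`, the closure of `C_c^∞(Ω)` in `W^{1,p(x)}(Ω)` for the norm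
`‖u‖_{p(x)} + ‖∇u‖_{p(x)}`. -/
def MemW10 {N : ℕ} (Ω : Set (Eu N)) (p : Eu N → ℝ) (u : Eu N → ℝ) : Prop :=
  MemW1 Ω p u ∧ ∀ ε : ℝ, 0 < ε → ∃ φ : Eu N → ℝ, IsTest Ω φ ∧
    luxNorm Ω p (fun x => u x - φ x) +
      luxNorm Ω p (fun x => weakGrad Ω u x - gradient φ x) < ε

/-- The space `L¹(Ω)`. -/
abbrev L1 {N : ℕ} (Ω : Set (Eu N)) : Type := Lp ℝ 1 (volume.restrict Ω)

open Classical in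
/-- The functional on `L¹(Ω)` equal to `‖∇u‖_{p(x)}` on `W_0^{1,p(x)}(Ω)` and `+∞` elsewhere. -/
def energy {N : ℕ} (Ω : Set (Eu N)) (p : Eu N → ℝ) (u : L1 Ω) : ENNReal :=
  if MemW10 Ω p u then ENNReal.ofReal (luxNorm Ω p (weakGrad Ω u)) else ⊤

open Classical in
/-- The functional on `L¹(Ω)` equal to `‖u‖_{p(x)}` on `L^{p(x)}(Ω)` and `0` elsewhere. -/
def gNorm {N : ℕ} (Ω : Set (Eu N)) (p : Eu N → ℝ) (u : L1 Ω) : ℝ :=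
  if MemLpVar Ω p u then luxNorm Ω p u else 0

/-- `p_I = inf_{h ≥ h̄} (p_h)₋`. -/
def tailInf {N : ℕ} (Ω : Set (Eu N)) (ph : ℕ → Eu N → ℝ) (hbar : ℕ) : ℝ :=
  sInf ((fun h => expInf Ω (ph h)) '' Ici hbar)

/-- `p_S = sup_{h ≥ h̄} (p_h)₊`. -/
def tailSup {N : ℕ} (Ω : Set (Eu N)) (ph : ℕ → Eu N → ℝ) (hbar : ℕ) : ℝ :=
  sSup ((fun h => expSup Ω (ph h)) '' Ici hbar)

/-- The critical Sobolev exponent `q^* = N q / (N - q)`, for `q < N`. -/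
def sobolevConj (N : ℕ) (q : ℝ) : ℝ := N * q / (N - q)

end VarExp

end

/-! Test functions are dense in `W₀^{1,p(x)}`, so each `u n` may be replaced by a test function
`φ n` at distance at most `1 / (n + 1)` in the Luxemburg norm, with gradients still bounded. As the
exponents are at least `q = p_I`, the `φ n` are bounded in `W^{1,q}`: by Rellich's theorem a
subsequence converges in `L¹` and almost everywhere, and by the Sobolev inequality the `φ n` are
bounded in `L^{q*}`. The exponents are at most `p_S < q*`, so Vitali's theorem gives convergence of
the modulars of `γ⁻¹ φ n` for every `γ > 0`, and the Luxemburg norm is determined by which of these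
modulars are at most `1`. -/

namespace VarExp

open scoped NNReal ENNReal

section Translation

variable {E F : Type*} [NormedAddCommGroup E] [NormedSpace ℝ E]
  [NormedAddCommGroup F] [NormedSpace ℝ F] {f : E → F}

theorem enorm_sub_le_lintegral_fderiv [CompleteSpace F] (hf : ContDiff ℝ 1 f) (x z : E) :
    ‖f (x + z) - f x‖ₑ ≤ ∫⁻ t in Ioc (0 : ℝ) 1, ‖fderiv ℝ f (x + t • z)‖ₑ * ‖z‖ₑ := by
  have hcont : Continuous fun t : ℝ => fderiv ℝ f (x + t • z) z :=
    ((hf.continuous_fderiv one_ne_zero).comp (by fun_prop)).clm_apply continuous_const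
  have hderiv (t : ℝ) : HasDerivAt (fun t : ℝ => f (x + t • z)) (fderiv ℝ f (x + t • z) z) t :=
    (hf.differentiable one_ne_zero _).hasFDerivAt.comp_hasDerivAt t
      (by simpa using ((hasDerivAt_id t).smul_const z).const_add x)
  have hftc : f (x + z) - f x = ∫ t in Ioc (0 : ℝ) 1, fderiv ℝ f (x + t • z) z := by
    rw [← intervalIntegral.integral_of_le zero_le_one,
      intervalIntegral.integral_eq_sub_of_hasDerivAt (fun t _ => hderiv t)
        (hcont.intervalIntegrable 0 1)]
    simp
  rw [hftc]
  exact (enorm_integral_le_lintegral_enorm _).trans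
    (lintegral_mono fun t => ContinuousLinearMap.le_opENorm _ _)

variable [MeasurableSpace E] [BorelSpace E] {μ : Measure E} [SFinite μ]
  [μ.IsAddLeftInvariant]

theorem lintegral_enorm_translate_sub_le [CompleteSpace F] (hf : ContDiff ℝ 1 f) (z : E) :
    ∫⁻ x, ‖f (x + z) - f x‖ₑ ∂μ ≤ ‖z‖ₑ * ∫⁻ x, ‖fderiv ℝ f x‖ₑ ∂μ := by
  have hf' : Continuous (fderiv ℝ f) := hf.continuous_fderiv one_ne_zero
  have hcont : Continuous fun w : E × ℝ => ‖fderiv ℝ f (w.1 + w.2 • z)‖ₑ :=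
    (hf'.comp (by fun_prop)).enorm
  have htranslate (t : ℝ) : ∫⁻ x, ‖fderiv ℝ f (x + t • z)‖ₑ * ‖z‖ₑ ∂μ =
      ‖z‖ₑ * ∫⁻ x, ‖fderiv ℝ f x‖ₑ ∂μ := by
    rw [lintegral_mul_const' _ _ enorm_ne_top, mul_comm,
      lintegral_add_right_eq_self (fun x => ‖fderiv ℝ f x‖ₑ) (t • z)]
  calc ∫⁻ x, ‖f (x + z) - f x‖ₑ ∂μ
      ≤ ∫⁻ x, (∫⁻ t in Ioc (0 : ℝ) 1, ‖fderiv ℝ f (x + t • z)‖ₑ * ‖z‖ₑ) ∂μ :=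
        lintegral_mono fun x => enorm_sub_le_lintegral_fderiv hf x z
    _ = ∫⁻ t in Ioc (0 : ℝ) 1, (∫⁻ x, ‖fderiv ℝ f (x + t • z)‖ₑ * ‖z‖ₑ ∂μ) :=
        lintegral_lintegral_swap
          (hcont.measurable.mul_const _).aemeasurable
    _ = ‖z‖ₑ * ∫⁻ x, ‖fderiv ℝ f x‖ₑ ∂μ := by
        simp only [htranslate, lintegral_const, Measure.restrict_apply_univ, Real.volume_Ioc,
          sub_zero, ENNReal.ofReal_one, mul_one]

end Translation

theorem lintegral_le_mul_of_le_smul {α : Type*} [MeasurableSpace α] {μ ν : Measure α} {C : ℝ≥0}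
    (hν : ν ≤ C • μ) (g : α → ℝ≥0∞) : ∫⁻ z, g z ∂ν ≤ C * ∫⁻ z, g z ∂μ :=
  (lintegral_mono' hν le_rfl).trans_eq (lintegral_smul_measure _ _)

section Averaging

variable {E F : Type*} [NormedAddCommGroup E] [MeasurableSpace E] [BorelSpace E]
  [NormedAddCommGroup F]

theorem integrable_translate {ν : Measure E} [IsFiniteMeasureOnCompacts ν] {f : E → F}
    (hf : Continuous f) (hs : HasCompactSupport f) (x : E) : Integrable (fun z => f (x + z)) ν :=
  (hf.comp (continuous_const_add x)).integrable_of_hasCompactSupport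
    (hs.comp_homeomorph (Homeomorph.addLeft x))

theorem exists_averaging_measure [ProperSpace E] (μ : Measure E) [IsLocallyFiniteMeasure μ]
    [μ.IsOpenPosMeasure] {δ : ℝ} (hδ : 0 < δ) :
    ∃ (ν : Measure E) (C : ℝ≥0), IsProbabilityMeasure ν ∧ ν ≤ C • μ ∧
      ∀ᵐ z ∂ν, ‖z‖ₑ ≤ ENNReal.ofReal δ := by
  have hpos : μ (Metric.ball 0 δ) ≠ 0 := (Metric.measure_ball_pos _ _ hδ).ne'
  refine ⟨ProbabilityTheory.cond μ (Metric.ball 0 δ), (μ (Metric.ball 0 δ))⁻¹.toNNReal,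
    ProbabilityTheory.cond_isProbabilityMeasure_of_finite hpos measure_ball_lt_top.ne, ?_, ?_⟩
  · rw [← Measure.coe_nnreal_smul, ENNReal.coe_toNNReal (ENNReal.inv_ne_top.2 hpos)]
    exact smul_mono_right _ Measure.restrict_le_self
  · refine Measure.ae_smul_measure ?_ _
    filter_upwards [ae_restrict_mem Metric.isOpen_ball.measurableSet] with z hz
    rw [← ofReal_norm]
    exact ENNReal.ofReal_le_ofReal (mem_ball_zero_iff.1 hz).le

variable [NormedSpace ℝ F]

/-- The average `∫ f (x + z) dν(z)` of the translates of `f`. Translating `f` by `x`, rather than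
reflecting as in a convolution, keeps `ν` unrestricted. -/
noncomputable def translateAvg (ν : Measure E) (f : E → F) (x : E) : F := ∫ z, f (x + z) ∂ν

variable {μ ν : Measure E} {C : ℝ≥0} {f : E → F}

theorem enorm_translateAvg_le [μ.IsAddLeftInvariant] (hν : ν ≤ C • μ) (x : E) :
    ‖translateAvg ν f x‖ₑ ≤ C * ∫⁻ y, ‖f y‖ₑ ∂μ := by
  refine (enorm_integral_le_lintegral_enorm _).trans ((lintegral_le_mul_of_le_smul hν _).trans ?_)
  rw [lintegral_add_left_eq_self (fun y => ‖f y‖ₑ) x]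

variable [NormedSpace ℝ E] [SFinite μ] [μ.IsAddLeftInvariant] [CompleteSpace F]

theorem lipschitzWith_translateAvg [IsFiniteMeasureOnCompacts ν] (hν : ν ≤ C • μ)
    (hf : ContDiff ℝ 1 f) (hs : HasCompactSupport f) {D : ℝ≥0}
    (hD : ∫⁻ y, ‖fderiv ℝ f y‖ₑ ∂μ ≤ D) : LipschitzWith (C * D) (translateAvg ν f) := by
  intro x y
  have htranslate : ∫⁻ z, ‖f (x + z) - f (y + z)‖ₑ ∂μ = ∫⁻ z, ‖f (z + (x - y)) - f z‖ₑ ∂μ := by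
    rw [← lintegral_add_left_eq_self (fun z => ‖f (z + (x - y)) - f z‖ₑ) y]
    refine lintegral_congr fun z => ?_
    congr 3
    abel
  rw [edist_eq_enorm_sub, translateAvg, translateAvg,
    ← integral_sub (integrable_translate hf.continuous hs x)
      (integrable_translate hf.continuous hs y)]
  calc ‖∫ z, (f (x + z) - f (y + z)) ∂ν‖ₑ
      ≤ C * ∫⁻ z, ‖f (x + z) - f (y + z)‖ₑ ∂μ :=
        (enorm_integral_le_lintegral_enorm _).trans (lintegral_le_mul_of_le_smul hν _)
    _ ≤ C * (‖x - y‖ₑ * D) := by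
        rw [htranslate]
        gcongr
        exact (lintegral_enorm_translate_sub_le hf _).trans (by gcongr)
    _ = ↑(C * D) * edist x y := by rw [edist_eq_enorm_sub, ENNReal.coe_mul]; ring

theorem lintegral_enorm_sub_translateAvg_le [SecondCountableTopology E] [IsProbabilityMeasure ν]
    {δ : ℝ≥0∞} (hδ : ∀ᵐ z ∂ν, ‖z‖ₑ ≤ δ) (hf : ContDiff ℝ 1 f) (hs : HasCompactSupport f) :
    ∫⁻ x, ‖f x - translateAvg ν f x‖ₑ ∂μ ≤ δ * ∫⁻ y, ‖fderiv ℝ f y‖ₑ ∂μ := by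
  have hpointwise (x : E) : ‖f x - translateAvg ν f x‖ₑ ≤ ∫⁻ z, ‖f (x + z) - f x‖ₑ ∂ν := by
    have : translateAvg ν f x - f x = ∫ z, (f (x + z) - f x) ∂ν := by
      rw [integral_sub (integrable_translate hf.continuous hs x) (integrable_const _)]
      simp [translateAvg]
    rw [← enorm_neg, neg_sub, this]
    exact enorm_integral_le_lintegral_enorm _
  have hcont : Continuous fun w : E × E => ‖f (w.1 + w.2) - f w.1‖ₑ :=
    ((hf.continuous.comp continuous_add).sub (hf.continuous.comp continuous_fst)).enorm
  calc ∫⁻ x, ‖f x - translateAvg ν f x‖ₑ ∂μ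
      ≤ ∫⁻ x, (∫⁻ z, ‖f (x + z) - f x‖ₑ ∂ν) ∂μ := lintegral_mono hpointwise
    _ = ∫⁻ z, (∫⁻ x, ‖f (x + z) - f x‖ₑ ∂μ) ∂ν :=
        lintegral_lintegral_swap hcont.measurable.aemeasurable
    _ ≤ ∫⁻ _, (δ * ∫⁻ y, ‖fderiv ℝ f y‖ₑ ∂μ) ∂ν :=
        lintegral_mono_ae (hδ.mono fun z hz =>
          (lintegral_enorm_translate_sub_le hf z).trans (by gcongr))
    _ = δ * ∫⁻ y, ‖fderiv ℝ f y‖ₑ ∂μ := by rw [lintegral_const, measure_univ, mul_one]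

end Averaging

section TotallyBounded

variable {ι X : Type*} [PseudoEMetricSpace X] {a : ι → X}

theorem totallyBounded_range_iff : TotallyBounded (range a) ↔
    ∀ ε : ℝ≥0∞, 0 < ε → ∃ t : Set ι, t.Finite ∧ ∀ i, ∃ j ∈ t, edist (a i) (a j) < ε := by
  simp only [EMetric.totallyBounded_iff', ← image_univ, exists_subset_image_finite_and]
  simp [subset_def]

theorem totallyBounded_range_of_approx
    (h : ∀ ε : ℝ≥0∞, 0 < ε → ∃ b : ι → X, TotallyBounded (range b) ∧ ∀ i, edist (a i) (b i) < ε) :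
    TotallyBounded (range a) := by
  refine totallyBounded_range_iff.2 fun ε hε => ?_
  have hε3 : 0 < ε / 3 := ENNReal.div_pos hε.ne' (by norm_num)
  obtain ⟨b, hb, hab⟩ := h (ε / 3) hε3
  obtain ⟨t, htf, ht⟩ := totallyBounded_range_iff.1 hb (ε / 3) hε3
  refine ⟨t, htf, fun i => ?_⟩
  obtain ⟨j, hj, hij⟩ := ht i
  refine ⟨j, hj, ?_⟩
  calc edist (a i) (a j) ≤ edist (a i) (b i) + edist (b i) (b j) + edist (a j) (b j) := by
        rw [edist_comm (a j)]
        exact edist_triangle4 _ _ _ _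
    _ < ε / 3 + ε / 3 + ε / 3 := ENNReal.add_lt_add (ENNReal.add_lt_add (hab i) hij) (hab j)
    _ = ε := ENNReal.add_thirds ε

end TotallyBounded

section Ascoli

variable {ι E F : Type*} [PseudoMetricSpace E] {A : Set E} {G : ι → E → F}

theorem exists_finite_forall_edist_le_of_uniformEquicontinuous [PseudoMetricSpace F] [ProperSpace F]
    (hA : TotallyBounded A) (hG : UniformEquicontinuous G)
    (hbdd : ∀ x ∈ A, Bornology.IsBounded (range fun i => G i x)) {ε : ℝ≥0∞} (hε : 0 < ε) :
    ∃ t : Set ι, t.Finite ∧ ∀ i, ∃ j ∈ t, ∀ x ∈ A, edist (G i x) (G j x) ≤ ε := by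
  have hε3 : 0 < ε / 3 := ENNReal.div_pos hε.ne' (by norm_num)
  obtain ⟨δ, hδ, hGδ⟩ := mem_uniformity_edist.1 (hG _ (edist_mem_uniformity hε3))
  obtain ⟨T, hTA, hTf, hT⟩ := EMetric.totallyBounded_iff'.1 hA δ hδ
  have := hTf.to_subtype
  have := Fintype.ofFinite T
  have hvalues : TotallyBounded (range fun i (y : T) => G i y) := by
    refine TotallyBounded.subset subset_closure (Bornology.IsBounded.isCompact_closure
      (Bornology.forall_isBounded_image_eval_iff.1 fun y => ?_)).totallyBounded
    rw [← range_comp]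
    exact hbdd y (hTA y.2)
  obtain ⟨t, htf, ht⟩ := totallyBounded_range_iff.1 hvalues (ε / 3) hε3
  refine ⟨t, htf, fun i => ?_⟩
  obtain ⟨j, hj, hij⟩ := ht i
  refine ⟨j, hj, fun x hx => ?_⟩
  obtain ⟨y, hy, hxy⟩ := mem_iUnion₂.1 (hT hx)
  have hijy : edist (G i y) (G j y) < ε / 3 :=
    (edist_le_pi_edist (fun y : T => G i y) (fun y : T => G j y) ⟨y, hy⟩).trans_lt hij
  calc edist (G i x) (G j x)
      ≤ edist (G i x) (G i y) + edist (G i y) (G j y) + edist (G j y) (G j x) :=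
        edist_triangle4 _ _ _ _
    _ ≤ ε / 3 + ε / 3 + ε / 3 :=
        add_le_add (add_le_add (hGδ hxy i).le hijy.le) (hGδ (Metric.mem_eball_comm.1 hxy) j).le
    _ = ε := ENNReal.add_thirds _

theorem totallyBounded_range_Lp_of_uniformEquicontinuous [MeasurableSpace E] {μ : Measure E}
    [IsFiniteMeasure μ] [NormedAddCommGroup F] [ProperSpace F] {p : ℝ≥0∞} [Fact (1 ≤ p)]
    (hA : TotallyBounded A) (hμA : ∀ᵐ x ∂μ, x ∈ A) (hG : UniformEquicontinuous G)
    (hbdd : ∀ x ∈ A, Bornology.IsBounded (range fun i => G i x)) {b : ι → Lp F p μ}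
    (hb : ∀ i, b i =ᵐ[μ] G i) : TotallyBounded (range b) := by
  refine totallyBounded_range_iff.2 fun ε hε => ?_
  have hμ : μ univ ^ p.toReal⁻¹ ≠ ⊤ :=
    (ENNReal.rpow_lt_top_of_nonneg (by positivity) (measure_ne_top μ univ)).ne
  obtain ⟨η, hη, hημ⟩ := ENNReal.exists_nnreal_pos_mul_lt hμ hε.ne'
  obtain ⟨t, htf, ht⟩ :=
    exists_finite_forall_edist_le_of_uniformEquicontinuous hA hG hbdd (ENNReal.coe_pos.2 hη)
  refine ⟨t, htf, fun i => ?_⟩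
  obtain ⟨j, hj, hij⟩ := ht i
  refine ⟨j, hj, ?_⟩
  rw [Lp.edist_def]
  refine (eLpNorm_le_of_ae_enorm_bound (C := η) ?_).trans_lt (by rwa [smul_eq_mul])
  filter_upwards [hμA, hb i, hb j] with x hx hi hj
  rw [Pi.sub_apply, hi, hj, ← edist_eq_enorm_sub]
  exact hij x hx

end Ascoli

section Rellich

variable {E F : Type*} [NormedAddCommGroup E] [NormedSpace ℝ E] [FiniteDimensional ℝ E]
  [MeasurableSpace E] [BorelSpace E] {μ : Measure E} [μ.IsAddHaarMeasure]
  [NormedAddCommGroup F] [NormedSpace ℝ F] [ProperSpace F] {Ω : Set E}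

theorem totallyBounded_range_of_lintegral_fderiv_le {ι : Type*} (hΩ : Bornology.IsBounded Ω)
    {φ : ι → E → F} (hφ : ∀ i, ContDiff ℝ 1 (φ i)) (hs : ∀ i, HasCompactSupport (φ i))
    {M D : ℝ≥0} (hM : ∀ i, ∫⁻ x, ‖φ i x‖ₑ ∂μ ≤ M) (hD : ∀ i, ∫⁻ x, ‖fderiv ℝ (φ i) x‖ₑ ∂μ ≤ D)
    {a : ι → Lp F 1 (μ.restrict Ω)} (ha : ∀ i, a i =ᵐ[μ.restrict Ω] φ i) :
    TotallyBounded (range a) := by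
  refine totallyBounded_range_of_approx fun ε hε => ?_
  obtain ⟨δ, hδ, hδD⟩ := ENNReal.exists_nnreal_pos_mul_lt (ENNReal.coe_ne_top (r := D)) hε.ne'
  obtain ⟨ν, C, hν, hνμ, hνδ⟩ := exists_averaging_measure μ (NNReal.coe_pos.2 hδ)
  have : IsFiniteMeasure (μ.restrict Ω) := ⟨by simpa using hΩ.measure_lt_top⟩
  have hlip (i : ι) : LipschitzWith (C * D) (translateAvg ν (φ i)) :=
    lipschitzWith_translateAvg hνμ (hφ i) (hs i) (hD i)
  have hbound (i : ι) (x : E) : ‖translateAvg ν (φ i) x‖ ≤ C * M := by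
    have := (enorm_translateAvg_le hνμ x).trans (mul_le_mul_right (hM i) C)
    exact_mod_cast this
  have hmem (i : ι) : MemLp (translateAvg ν (φ i)) 1 (μ.restrict Ω) :=
    .of_bound (hlip i).continuous.aestronglyMeasurable _ (Eventually.of_forall (hbound i))
  refine ⟨fun i => (hmem i).toLp, ?_, fun i => ?_⟩
  · refine totallyBounded_range_Lp_of_uniformEquicontinuous
      hΩ.isCompact_closure.totallyBounded
      (ae_restrict_of_ae_restrict_of_subset subset_closure
        (ae_restrict_mem isClosed_closure.measurableSet))
      (LipschitzWith.uniformEquicontinuous _ _ hlip) (fun x _ => ?_) fun i => (hmem i).coeFn_toLp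
    exact isBounded_iff_forall_norm_le.2 ⟨C * M, forall_mem_range.2 fun i => hbound i x⟩
  · rw [Lp.edist_def, eLpNorm_congr_ae ((ha i).sub (hmem i).coeFn_toLp),
      eLpNorm_one_eq_lintegral_enorm]
    calc ∫⁻ x in Ω, ‖φ i x - translateAvg ν (φ i) x‖ₑ ∂μ
        ≤ ∫⁻ x, ‖φ i x - translateAvg ν (φ i) x‖ₑ ∂μ := setLIntegral_le_lintegral _ _
      _ ≤ ENNReal.ofReal δ * ∫⁻ x, ‖fderiv ℝ (φ i) x‖ₑ ∂μ :=
        lintegral_enorm_sub_translateAvg_le hνδ (hφ i) (hs i)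
      _ ≤ δ * D := by rw [ENNReal.ofReal_coe_nnreal]; gcongr; exact hD i
      _ < ε := hδD

theorem exists_subseq_tendsto_of_lintegral_fderiv_le (hΩ : Bornology.IsBounded Ω)
    {φ : ℕ → E → F} (hφ : ∀ n, ContDiff ℝ 1 (φ n)) (hs : ∀ n, HasCompactSupport (φ n))
    {M D : ℝ≥0} (hM : ∀ n, ∫⁻ x, ‖φ n x‖ₑ ∂μ ≤ M)
    (hD : ∀ n, ∫⁻ x, ‖fderiv ℝ (φ n) x‖ₑ ∂μ ≤ D) :
    ∃ (s : ℕ → ℕ) (v : Lp F 1 (μ.restrict Ω)), StrictMono s ∧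
      Tendsto (fun j => eLpNorm (φ (s j) - ⇑v) 1 (μ.restrict Ω)) atTop (𝓝 0) ∧
      ∀ᵐ x ∂μ.restrict Ω, Tendsto (fun j => φ (s j) x) atTop (𝓝 (v x)) := by
  have hL1 (n : ℕ) : MemLp (φ n) 1 (μ.restrict Ω) :=
    ((hφ n).continuous.memLp_of_hasCompactSupport (hs n)).restrict Ω
  have hcompact : IsCompact (closure (range fun n => (hL1 n).toLp)) :=
    (totallyBounded_range_of_lintegral_fderiv_le hΩ hφ hs hM hD
      fun n => (hL1 n).coeFn_toLp).closure.isCompact_of_isClosed isClosed_closure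
  obtain ⟨v, -, s, hsm, hlim⟩ :=
    hcompact.tendsto_subseq fun n => subset_closure (mem_range_self n)
  have hnorm : Tendsto (fun j => eLpNorm (φ (s j) - ⇑v) 1 (μ.restrict Ω)) atTop (𝓝 0) :=
    ((Lp.tendsto_Lp_iff_tendsto_eLpNorm' _ _).1 hlim).congr fun j =>
      eLpNorm_congr_ae ((hL1 (s j)).coeFn_toLp.sub EventuallyEq.rfl)
  obtain ⟨t, ht, hae⟩ := (tendstoInMeasure_of_tendsto_eLpNorm one_ne_zero
    (fun j => (hL1 (s j)).aestronglyMeasurable) (Lp.aestronglyMeasurable v)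
    hnorm).exists_seq_tendsto_ae
  exact ⟨s ∘ t, v, hsm.comp ht, hnorm.comp ht.tendsto_atTop, hae⟩

end Rellich

theorem rpow_le_one_add_rpow (t : ℝ≥0∞) {a b : ℝ} (ha : 0 ≤ a) (hab : a ≤ b) :
    t ^ a ≤ 1 + t ^ b := by
  rcases le_total t 1 with h | h
  · exact (ENNReal.rpow_le_one h ha).trans le_self_add
  · exact (ENNReal.rpow_le_rpow_of_exponent_le h hab).trans le_add_self

theorem lintegral_rpow_le_measure_univ_add {α : Type*} [MeasurableSpace α] {μ : Measure α}
    (f : α → ℝ≥0∞) {a b : α → ℝ} (ha : ∀ᵐ x ∂μ, 0 ≤ a x) (hab : ∀ᵐ x ∂μ, a x ≤ b x) :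
    ∫⁻ x, f x ^ a x ∂μ ≤ μ univ + ∫⁻ x, f x ^ b x ∂μ :=
  calc ∫⁻ x, f x ^ a x ∂μ ≤ ∫⁻ x, (1 + f x ^ b x) ∂μ := by
        refine lintegral_mono_ae ?_
        filter_upwards [ha, hab] with x hx hx' using rpow_le_one_add_rpow _ hx hx'
    _ = μ univ + ∫⁻ x, f x ^ b x ∂μ := by rw [lintegral_add_left measurable_const, lintegral_one]

/-- The measurable exponents with values in `[q, S]` almost everywhere in `Ω`: the class of
exponents for which the estimates below are uniform. -/
structure IsBoundedExponent {N : ℕ} (Ω : Set (Eu N)) (q S : ℝ) (p : Eu N → ℝ) : Prop where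
  aemeasurable : AEMeasurable p (volume.restrict Ω)
  ae_ge : ∀ᵐ x ∂volume.restrict Ω, q ≤ p x
  ae_le : ∀ᵐ x ∂volume.restrict Ω, p x ≤ S

section Modular

variable {N : ℕ} {F : Type*} [NormedAddCommGroup F] {Ω : Set (Eu N)} {p : Eu N → ℝ} {q S : ℝ}
  {f g : Eu N → F}

theorem IsBoundedExponent.ae_ge_of_le {c : ℝ} (hp : IsBoundedExponent Ω q S p) (hc : c ≤ q) :
    ∀ᵐ x ∂volume.restrict Ω, c ≤ p x :=
  hp.ae_ge.mono fun _ => hc.trans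

theorem modular_neg (f : Eu N → F) : modular Ω p (-f) = modular Ω p f := by
  simp only [modular, Pi.neg_apply, enorm_neg]

theorem MemLpVar.of_bound (hΩ : volume Ω ≠ ⊤) (hq : 0 ≤ q) (hp : IsBoundedExponent Ω q S p)
    (hf : AEStronglyMeasurable f (volume.restrict Ω)) {C : ℝ} (hC : ∀ x, ‖f x‖ ≤ C) :
    MemLpVar Ω p f := by
  refine ⟨hf, ?_⟩
  calc modular Ω p f ≤ ∫⁻ _ in Ω, (1 + ENNReal.ofReal C) ^ S := by
        refine lintegral_mono_ae ?_
        filter_upwards [hp.ae_ge_of_le hq, hp.ae_le] with x hx0 hxS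
        have hfx : ‖f x‖ₑ ≤ 1 + ENNReal.ofReal C := by
          rw [← ofReal_norm]
          exact (ENNReal.ofReal_le_ofReal (hC x)).trans le_add_self
        exact (ENNReal.rpow_le_rpow hfx hx0).trans
          (ENNReal.rpow_le_rpow_of_exponent_le le_self_add hxS)
    _ < ⊤ := by
        rw [setLIntegral_const]
        exact ENNReal.mul_lt_top (ENNReal.rpow_ne_top_of_ne_zero (by simp) (by simp)).lt_top
          hΩ.lt_top

theorem MemLpVar.of_hasCompactSupport (hΩ : volume Ω ≠ ⊤) (hq : 0 ≤ q)
    (hp : IsBoundedExponent Ω q S p) (hf : Continuous f) (hs : HasCompactSupport f) :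
    MemLpVar Ω p f :=
  let ⟨_, hC⟩ := hs.exists_bound_of_continuous hf
  .of_bound hΩ hq hp hf.aestronglyMeasurable hC

variable [NormedSpace ℝ F]

theorem modular_smul_le (hp : ∀ᵐ x ∂volume.restrict Ω, 1 ≤ p x) {c : ℝ} (hc₀ : 0 ≤ c)
    (hc₁ : c ≤ 1) (f : Eu N → F) : modular Ω p (c • f) ≤ ENNReal.ofReal c * modular Ω p f := by
  rw [modular, modular, ← lintegral_const_mul' _ _ ENNReal.ofReal_ne_top]
  refine lintegral_mono_ae (hp.mono fun x hx => ?_)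
  rw [Pi.smul_apply, enorm_smul, ENNReal.mul_rpow_of_nonneg _ _ (zero_le_one.trans hx),
    Real.enorm_eq_ofReal hc₀]
  gcongr
  exact ENNReal.rpow_le_self_of_le_one (ENNReal.ofReal_le_one.2 hc₁) hx

theorem modular_convexComb_le (hpm : AEMeasurable p (volume.restrict Ω))
    (hp : ∀ᵐ x ∂volume.restrict Ω, 1 ≤ p x) (hf : AEStronglyMeasurable f (volume.restrict Ω))
    {a b : ℝ} (ha : 0 ≤ a) (hb : 0 ≤ b) (hab : a + b = 1) :
    modular Ω p (a • f + b • g) ≤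
      ENNReal.ofReal a * modular Ω p f + ENNReal.ofReal b * modular Ω p g := by
  have hweights : ENNReal.ofReal a + ENNReal.ofReal b = 1 := by
    rw [← ENNReal.ofReal_add ha hb, hab, ENNReal.ofReal_one]
  rw [modular, modular, modular, ← lintegral_const_mul' _ _ ENNReal.ofReal_ne_top,
    ← lintegral_const_mul' _ _ ENNReal.ofReal_ne_top,
    ← lintegral_add_left' ((hf.enorm.pow hpm).const_mul _)]
  refine lintegral_mono_ae (hp.mono fun x hx => ?_)
  calc ‖(a • f + b • g) x‖ₑ ^ p x
      ≤ (ENNReal.ofReal a * ‖f x‖ₑ + ENNReal.ofReal b * ‖g x‖ₑ) ^ p x := by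
        gcongr
        refine (enorm_add_le _ _).trans_eq ?_
        rw [Pi.smul_apply, Pi.smul_apply, enorm_smul, enorm_smul, Real.enorm_eq_ofReal ha,
          Real.enorm_eq_ofReal hb]
    _ ≤ ENNReal.ofReal a * ‖f x‖ₑ ^ p x + ENNReal.ofReal b * ‖g x‖ₑ ^ p x :=
        ENNReal.rpow_arith_mean_le_arith_mean2_rpow _ _ _ _ hweights hx

theorem MemLpVar.const_smul (hq : 0 ≤ q) (hp : IsBoundedExponent Ω q S p) (hf : MemLpVar Ω p f)
    (c : ℝ) : MemLpVar Ω p (c • f) := by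
  refine ⟨hf.1.const_smul c, ?_⟩
  have hfin : (1 + ‖c‖ₑ) ^ S ≠ ⊤ := ENNReal.rpow_ne_top_of_ne_zero (by simp) (by simp)
  calc modular Ω p (c • f) ≤ ∫⁻ x in Ω, (1 + ‖c‖ₑ) ^ S * ‖f x‖ₑ ^ p x := by
        refine lintegral_mono_ae ?_
        filter_upwards [hp.ae_ge_of_le hq, hp.ae_le] with x hx0 hxS
        rw [Pi.smul_apply, enorm_smul, ENNReal.mul_rpow_of_nonneg _ _ hx0]
        gcongr
        exact (ENNReal.rpow_le_rpow le_add_self hx0).trans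
          (ENNReal.rpow_le_rpow_of_exponent_le le_self_add hxS)
    _ = (1 + ‖c‖ₑ) ^ S * modular Ω p f := lintegral_const_mul' _ _ hfin
    _ < ⊤ := ENNReal.mul_lt_top hfin.lt_top hf.2

theorem MemLpVar.add (hq : 1 ≤ q) (hp : IsBoundedExponent Ω q S p) (hf : MemLpVar Ω p f)
    (hg : MemLpVar Ω p g) : MemLpVar Ω p (f + g) := by
  have hq₀ : 0 ≤ q := zero_le_one.trans hq
  have hhalf (h : Eu N → F) : h = (1 / 2 : ℝ) • (2 : ℝ) • h := by rw [smul_smul]; norm_num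
  refine ⟨hf.1.add hg.1, ?_⟩
  rw [hhalf f, hhalf g]
  refine (modular_convexComb_le hp.aemeasurable (hp.ae_ge_of_le hq) (hf.1.const_smul 2)
    (by norm_num) (by norm_num) (by norm_num)).trans_lt (ENNReal.add_lt_top.2 ⟨?_, ?_⟩)
  · exact ENNReal.mul_lt_top ENNReal.ofReal_lt_top (hf.const_smul hq₀ hp 2).2
  · exact ENNReal.mul_lt_top ENNReal.ofReal_lt_top (hg.const_smul hq₀ hp 2).2

theorem MemLpVar.sub (hq : 1 ≤ q) (hp : IsBoundedExponent Ω q S p) (hf : MemLpVar Ω p f)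
    (hg : MemLpVar Ω p g) : MemLpVar Ω p (f - g) := by
  rw [sub_eq_add_neg]
  exact hf.add hq hp ⟨hg.1.neg, by rw [modular_neg]; exact hg.2⟩

theorem lintegral_rpow_le_of_modular_le_one (hq : 0 ≤ q)
    (hqp : ∀ᵐ x ∂volume.restrict Ω, q ≤ p x) {γ : ℝ} (hγ : 0 < γ)
    (h : modular Ω p (γ⁻¹ • f) ≤ 1) :
    ∫⁻ x in Ω, ‖f x‖ₑ ^ q ≤ ENNReal.ofReal γ ^ q * (volume Ω + 1) := by
  have hscale (x : Eu N) : ‖f x‖ₑ ^ q = ENNReal.ofReal γ ^ q * ‖(γ⁻¹ • f) x‖ₑ ^ q := by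
    rw [← ENNReal.mul_rpow_of_nonneg _ _ hq, ← Real.enorm_eq_ofReal hγ.le, ← enorm_smul,
      Pi.smul_apply, smul_inv_smul₀ hγ.ne']
  simp_rw [hscale]
  rw [lintegral_const_mul' _ _ (ENNReal.rpow_lt_top_of_nonneg hq ENNReal.ofReal_ne_top).ne]
  gcongr
  refine (lintegral_rpow_le_measure_univ_add _ (Eventually.of_forall fun _ => hq) hqp).trans ?_
  rw [Measure.restrict_apply_univ]
  gcongr
  exact h

end Modular

section Luxemburg

variable {N : ℕ} {F : Type*} [NormedAddCommGroup F] [NormedSpace ℝ F] {Ω : Set (Eu N)}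
  {p : Eu N → ℝ} {q S : ℝ} {f g : Eu N → F}

theorem luxNorm_nonneg : 0 ≤ luxNorm Ω p f := Real.sInf_nonneg fun _ h => h.1.le

theorem luxNorm_le {γ : ℝ} (hγ : 0 < γ) (h : modular Ω p (γ⁻¹ • f) ≤ 1) : luxNorm Ω p f ≤ γ :=
  csInf_le ⟨0, fun _ h => h.1.le⟩ ⟨hγ, h⟩

theorem luxNorm_neg (f : Eu N → F) : luxNorm Ω p (-f) = luxNorm Ω p f := by
  simp only [luxNorm, modular, Pi.neg_apply, smul_neg, enorm_neg]

theorem luxNorm_sub_comm (f g : Eu N → F) : luxNorm Ω p (f - g) = luxNorm Ω p (g - f) := by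
  rw [← luxNorm_neg, neg_sub]

theorem exists_modular_inv_smul_le_one (hp : ∀ᵐ x ∂volume.restrict Ω, 1 ≤ p x)
    (hf : modular Ω p f < ⊤) : ∃ γ : ℝ, 0 < γ ∧ modular Ω p (γ⁻¹ • f) ≤ 1 := by
  set m := (modular Ω p f).toReal with hm
  have hm₀ : 0 ≤ m := ENNReal.toReal_nonneg
  refine ⟨m + 1, by positivity, ?_⟩
  refine (modular_smul_le hp (by positivity) (inv_le_one_of_one_le₀ (by linarith)) f).trans ?_
  rw [← ENNReal.ofReal_toReal hf.ne, ← ENNReal.ofReal_mul (by positivity), ← hm,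
    ENNReal.ofReal_le_one, inv_mul_le_iff₀ (by positivity)]
  linarith

theorem modular_inv_smul_lt_one_of_luxNorm_lt (hp : ∀ᵐ x ∂volume.restrict Ω, 1 ≤ p x)
    (hf : modular Ω p f < ⊤) {γ : ℝ} (h : luxNorm Ω p f < γ) : modular Ω p (γ⁻¹ • f) < 1 := by
  obtain ⟨γ', ⟨hγ', hle⟩, hlt⟩ := exists_lt_of_csInf_lt (exists_modular_inv_smul_le_one hp hf) h
  have hγ : 0 < γ := hγ'.trans hlt
  have hsmul : γ⁻¹ • f = (γ' / γ) • γ'⁻¹ • f := by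
    rw [smul_smul]
    congr 1
    field_simp
  calc modular Ω p (γ⁻¹ • f) ≤ ENNReal.ofReal (γ' / γ) * modular Ω p (γ'⁻¹ • f) := by
        rw [hsmul]
        exact modular_smul_le hp (by positivity) ((div_le_one hγ).2 hlt.le) _
    _ ≤ ENNReal.ofReal (γ' / γ) := mul_le_of_le_one_right' hle
    _ < 1 := ENNReal.ofReal_lt_one.2 ((div_lt_one hγ).2 hlt)

theorem luxNorm_add_le (hpm : AEMeasurable p (volume.restrict Ω))
    (hp : ∀ᵐ x ∂volume.restrict Ω, 1 ≤ p x) (hf : MemLpVar Ω p f) (hg : MemLpVar Ω p g) :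
    luxNorm Ω p (f + g) ≤ luxNorm Ω p f + luxNorm Ω p g := by
  refine le_add_of_forall_lt fun a ha b hb => ?_
  have ha₀ : 0 < a := luxNorm_nonneg.trans_lt ha
  have hb₀ : 0 < b := luxNorm_nonneg.trans_lt hb
  have hcomb : (a + b)⁻¹ • (f + g) = (a / (a + b)) • a⁻¹ • f + (b / (a + b)) • b⁻¹ • g := by
    rw [smul_smul, smul_smul, smul_add]
    congr 2 <;> field_simp
  have hweights : a / (a + b) + b / (a + b) = 1 := by field_simp
  refine luxNorm_le (by positivity) ?_
  rw [hcomb]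
  calc modular Ω p ((a / (a + b)) • a⁻¹ • f + (b / (a + b)) • b⁻¹ • g)
      ≤ ENNReal.ofReal (a / (a + b)) * modular Ω p (a⁻¹ • f) +
          ENNReal.ofReal (b / (a + b)) * modular Ω p (b⁻¹ • g) :=
        modular_convexComb_le hpm hp (hf.1.const_smul _) (by positivity) (by positivity) hweights
    _ ≤ ENNReal.ofReal (a / (a + b)) * 1 + ENNReal.ofReal (b / (a + b)) * 1 := by
        gcongr
        · exact (modular_inv_smul_lt_one_of_luxNorm_lt hp hf.2 ha).le
        · exact (modular_inv_smul_lt_one_of_luxNorm_lt hp hg.2 hb).le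
    _ = 1 := by
        rw [mul_one, mul_one, ← ENNReal.ofReal_add (by positivity) (by positivity), hweights,
          ENNReal.ofReal_one]

theorem luxNorm_sub_luxNorm_le (hq : 1 ≤ q) (hp : IsBoundedExponent Ω q S p)
    (hf : MemLpVar Ω p f) (hg : MemLpVar Ω p g) :
    luxNorm Ω p f - luxNorm Ω p g ≤ luxNorm Ω p (f - g) := by
  have := luxNorm_add_le hp.aemeasurable (hp.ae_ge_of_le hq) (hf.sub hq hp hg) hg
  rw [sub_add_cancel] at this
  linarith

theorem abs_luxNorm_sub_luxNorm_le (hq : 1 ≤ q) (hp : IsBoundedExponent Ω q S p)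
    (hf : MemLpVar Ω p f) (hg : MemLpVar Ω p g) :
    |luxNorm Ω p f - luxNorm Ω p g| ≤ luxNorm Ω p (f - g) :=
  abs_sub_le_iff.2 ⟨luxNorm_sub_luxNorm_le hq hp hf hg,
    (luxNorm_sub_luxNorm_le hq hp hg hf).trans_eq (luxNorm_sub_comm g f)⟩

theorem tendsto_luxNorm {ι : Type*} {l : Filter ι} {P : ι → Eu N → ℝ} {G : ι → Eu N → F}
    (hP : ∀ i, ∀ᵐ x ∂volume.restrict Ω, 1 ≤ P i x) (hp : ∀ᵐ x ∂volume.restrict Ω, 1 ≤ p x)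
    (hG : ∀ i, modular Ω (P i) (G i) < ⊤) (hg : modular Ω p g < ⊤)
    (h : ∀ γ : ℝ, 0 < γ →
      Tendsto (fun i => modular Ω (P i) (γ⁻¹ • G i)) l (𝓝 (modular Ω p (γ⁻¹ • g)))) :
    Tendsto (fun i => luxNorm Ω (P i) (G i)) l (𝓝 (luxNorm Ω p g)) := by
  refine tendsto_order.2 ⟨fun a ha => ?_, fun a ha => ?_⟩
  · rcases lt_or_ge a 0 with ha₀ | ha₀
    · exact Eventually.of_forall fun i => ha₀.trans_le luxNorm_nonneg
    obtain ⟨γ, haγ, hγ⟩ := exists_between ha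
    have hγ₀ : 0 < γ := ha₀.trans_lt haγ
    have hlarge : 1 < modular Ω p (γ⁻¹ • g) := by
      by_contra! hle
      exact hγ.not_ge (luxNorm_le hγ₀ hle)
    filter_upwards [(h γ hγ₀).eventually_const_lt hlarge] with i hi
    refine haγ.trans_le ?_
    by_contra! hlt
    exact hi.not_gt (modular_inv_smul_lt_one_of_luxNorm_lt (hP i) (hG i) hlt)
  · obtain ⟨γ, hγ, hγa⟩ := exists_between ha
    have hγ₀ : 0 < γ := luxNorm_nonneg.trans_lt hγ
    filter_upwards [(h γ hγ₀).eventually_lt_const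
      (modular_inv_smul_lt_one_of_luxNorm_lt hp hg hγ)] with i hi
    exact (luxNorm_le hγ₀ hi.le).trans_lt hγa

end Luxemburg

section Vitali

theorem exists_le_min_add_mul_rpow {s : ℝ} (hs : 1 < s) {ε : ℝ≥0∞} (hε₀ : ε ≠ 0) (hε : ε ≠ ⊤) :
    ∃ A : ℝ≥0∞, A ≠ ⊤ ∧ ∀ t : ℝ≥0∞, t ≤ min t A + ε * t ^ s := by
  have hs' : 0 < s - 1 := sub_pos.2 hs
  refine ⟨ε⁻¹ ^ (s - 1)⁻¹,
    (ENNReal.rpow_lt_top_of_nonneg (by positivity) (ENNReal.inv_ne_top.2 hε₀)).ne, fun t => ?_⟩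
  rcases le_total t (ε⁻¹ ^ (s - 1)⁻¹) with h | h
  · rw [min_eq_left h]
    exact le_self_add
  have hlarge : ε⁻¹ ≤ t ^ (s - 1) := by
    simpa only [← ENNReal.rpow_mul, inv_mul_cancel₀ hs'.ne', ENNReal.rpow_one] using
      ENNReal.rpow_le_rpow h hs'.le
  calc t = ε * (ε⁻¹ * t) := by rw [← mul_assoc, ENNReal.mul_inv_cancel hε₀ hε, one_mul]
    _ ≤ ε * (t ^ (s - 1) * t ^ (1 : ℝ)) := by
        rw [ENNReal.rpow_one]
        gcongr
    _ = ε * t ^ s := by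
        rw [← ENNReal.rpow_add_of_nonneg _ _ hs'.le zero_le_one, sub_add_cancel]
    _ ≤ min t _ + ε * t ^ s := le_add_self

variable {α : Type*} [MeasurableSpace α] {μ : Measure α} {s : ℝ} {B : ℝ≥0∞}

theorem exists_lintegral_le_lintegral_min_add (hs : 1 < s) (hB : B ≠ ⊤) {ε : ℝ≥0∞}
    (hε : ε ≠ 0) : ∃ A : ℝ≥0∞, A ≠ ⊤ ∧ ∀ f : α → ℝ≥0∞, AEMeasurable f μ →
      ∫⁻ x, f x ^ s ∂μ ≤ B → ∫⁻ x, f x ∂μ ≤ ∫⁻ x, min (f x) A ∂μ + ε := by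
  obtain ⟨e, he, heB⟩ := ENNReal.exists_nnreal_pos_mul_lt hB hε
  obtain ⟨A, hA, hAt⟩ := exists_le_min_add_mul_rpow hs (ENNReal.coe_pos.2 he).ne'
    ENNReal.coe_ne_top
  refine ⟨A, hA, fun f hf hfB => ?_⟩
  calc ∫⁻ x, f x ∂μ ≤ ∫⁻ x, (min (f x) A + e * f x ^ s) ∂μ := lintegral_mono fun x => hAt _
    _ = ∫⁻ x, min (f x) A ∂μ + e * ∫⁻ x, f x ^ s ∂μ := by
        rw [lintegral_add_left' (hf.min aemeasurable_const),
          lintegral_const_mul' _ _ ENNReal.coe_ne_top]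
    _ ≤ ∫⁻ x, min (f x) A ∂μ + e * B := by gcongr
    _ ≤ ∫⁻ x, min (f x) A ∂μ + ε := by gcongr

theorem tendsto_lintegral_of_lintegral_rpow_le [IsFiniteMeasure μ] {G : ℕ → α → ℝ≥0∞}
    {g : α → ℝ≥0∞} (hG : ∀ n, AEMeasurable (G n) μ)
    (hlim : ∀ᵐ x ∂μ, Tendsto (fun n => G n x) atTop (𝓝 (g x))) (hs : 1 < s) (hB : B ≠ ⊤)
    (hGB : ∀ n, ∫⁻ x, G n x ^ s ∂μ ≤ B) :
    Tendsto (fun n => ∫⁻ x, G n x ∂μ) atTop (𝓝 (∫⁻ x, g x ∂μ)) := by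
  have hfatou : ∫⁻ x, g x ∂μ ≤ liminf (fun n => ∫⁻ x, G n x ∂μ) atTop :=
    (lintegral_congr_ae (hlim.mono fun x hx => hx.liminf_eq.symm)).trans_le
      (lintegral_liminf_le' hG)
  refine tendsto_of_le_liminf_of_limsup_le hfatou ?_
  refine ENNReal.le_of_forall_pos_le_add fun ε hε _ => ?_
  obtain ⟨A, hA, hAG⟩ := exists_lintegral_le_lintegral_min_add (μ := μ) hs hB
    (ENNReal.coe_pos.2 hε).ne'
  have htrunc : Tendsto (fun n => ∫⁻ x, min (G n x) A ∂μ) atTop (𝓝 (∫⁻ x, min (g x) A ∂μ)) := by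
    refine tendsto_lintegral_of_dominated_convergence' (fun _ => A)
      (fun n => (hG n).min aemeasurable_const)
      (fun n => Eventually.of_forall fun x => min_le_right _ _) ?_
      (hlim.mono fun x hx => hx.min tendsto_const_nhds)
    rw [lintegral_const]
    exact ENNReal.mul_ne_top hA (measure_ne_top _ _)
  calc limsup (fun n => ∫⁻ x, G n x ∂μ) atTop
      ≤ limsup (fun n => ∫⁻ x, min (G n x) A ∂μ + ε) atTop :=
        limsup_le_limsup (Eventually.of_forall fun n => hAG _ (hG n) (hGB n))
    _ = ∫⁻ x, min (g x) A ∂μ + ε := (htrunc.add tendsto_const_nhds).limsup_eq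
    _ ≤ ∫⁻ x, g x ∂μ + ε := by
        gcongr
        exact min_le_left _ _

theorem tendsto_enorm_rpow {ι F : Type*} [SeminormedAddCommGroup F] {l : Filter ι} {a : ι → F}
    {b : ι → ℝ} {x : F} {y : ℝ} (ha : Tendsto a l (𝓝 x)) (hb : Tendsto b l (𝓝 y)) (hy : 0 < y) :
    Tendsto (fun i => ‖a i‖ₑ ^ b i) l (𝓝 (‖x‖ₑ ^ y)) := by
  have hofReal (c : F) {d : ℝ} (hd : 0 < d) : ENNReal.ofReal (‖c‖ ^ d) = ‖c‖ₑ ^ d := by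
    rw [← ENNReal.ofReal_rpow_of_nonneg (norm_nonneg _) hd.le, ofReal_norm]
  rw [← hofReal x hy]
  refine (ENNReal.tendsto_ofReal (ha.norm.rpow hb (Or.inr hy))).congr' ?_
  filter_upwards [hb.eventually_const_lt hy] with i hi using hofReal (a i) hi

end Vitali

section VariableExponentLimit

variable {N : ℕ} {F : Type*} [NormedAddCommGroup F] {Ω : Set (Eu N)} {q S r : ℝ}
  {P : ℕ → Eu N → ℝ} {p : Eu N → ℝ} {G : ℕ → Eu N → F} {g : Eu N → F} {M : ℝ≥0∞}

theorem tendsto_modular (hΩ : volume Ω ≠ ⊤) (hq : 0 < q) (hqr : q < r) (hSr : S < r)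
    (hP : ∀ n, IsBoundedExponent Ω q S (P n))
    (hPp : ∀ᵐ x ∂volume.restrict Ω, Tendsto (fun n => P n x) atTop (𝓝 (p x)))
    (hG : ∀ n, AEStronglyMeasurable (G n) (volume.restrict Ω))
    (hlim : ∀ᵐ x ∂volume.restrict Ω, Tendsto (fun n => G n x) atTop (𝓝 (g x)))
    (hM : M ≠ ⊤) (hGM : ∀ n, ∫⁻ x in Ω, ‖G n x‖ₑ ^ r ≤ M) :
    Tendsto (fun n => modular Ω (P n) (G n)) atTop (𝓝 (modular Ω p g)) := by
  have : IsFiniteMeasure (volume.restrict Ω) := ⟨by simpa using hΩ.lt_top⟩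
  have hr : 0 < r := hq.trans hqr
  have hT : 0 < max q S := lt_max_of_lt_left hq
  refine tendsto_lintegral_of_lintegral_rpow_le (s := r / max q S) (B := volume Ω + M)
    (fun n => (hG n).enorm.pow (hP n).aemeasurable) ?_ ((one_lt_div hT).2 (max_lt hqr hSr))
    (ENNReal.add_ne_top.2 ⟨hΩ, hM⟩) fun n => ?_
  · filter_upwards [hlim, hPp, ae_all_iff.2 fun n => (hP n).ae_ge] with x hx hPx hqP
    exact tendsto_enorm_rpow hx hPx (hq.trans_le (ge_of_tendsto' hPx hqP))
  · simp_rw [← ENNReal.rpow_mul]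
    refine (lintegral_rpow_le_measure_univ_add (b := fun _ => r) _ ?_ ?_).trans ?_
    · filter_upwards [(hP n).ae_ge] with x hx
      have : 0 < P n x := hq.trans_le hx
      positivity
    · filter_upwards [(hP n).ae_le] with x hx
      calc P n x * (r / max q S) ≤ max q S * (r / max q S) := by
            gcongr
            exact hx.trans (le_max_right q S)
        _ = r := mul_div_cancel₀ r hT.ne'
    · rw [Measure.restrict_apply_univ]
      gcongr
      exact hGM n

theorem modular_le_volume_add (hq : 0 ≤ q) (hSr : S ≤ r) (hp : IsBoundedExponent Ω q S p)
    (g : Eu N → F) : modular Ω p g ≤ volume Ω + ∫⁻ x in Ω, ‖g x‖ₑ ^ r := by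
  rw [← Measure.restrict_apply_univ]
  exact lintegral_rpow_le_measure_univ_add _ (hp.ae_ge_of_le hq)
    (hp.ae_le.mono fun _ hx => hx.trans hSr)

variable [NormedSpace ℝ F]

theorem tendsto_luxNorm_of_lintegral_rpow_le (hΩ : volume Ω ≠ ⊤) (hq : 1 ≤ q) (hqr : q < r)
    (hSr : S < r) (hP : ∀ n, IsBoundedExponent Ω q S (P n))
    (hPp : ∀ᵐ x ∂volume.restrict Ω, Tendsto (fun n => P n x) atTop (𝓝 (p x)))
    (hG : ∀ n, AEStronglyMeasurable (G n) (volume.restrict Ω))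
    (hlim : ∀ᵐ x ∂volume.restrict Ω, Tendsto (fun n => G n x) atTop (𝓝 (g x)))
    (hM : M ≠ ⊤) (hGM : ∀ n, ∫⁻ x in Ω, ‖G n x‖ₑ ^ r ≤ M) :
    MemLpVar Ω p g ∧
      Tendsto (fun n => luxNorm Ω (P n) (G n)) atTop (𝓝 (luxNorm Ω p g)) := by
  have hq₀ : 0 < q := zero_lt_one.trans_le hq
  have hr : 0 ≤ r := hq₀.le.trans hqr.le
  have hmod : ∀ n, modular Ω (P n) (G n) ≤ volume Ω + M := fun n =>
    (modular_le_volume_add hq₀.le hSr.le (hP n) (G n)).trans (by grw [hGM n])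
  have hfin : volume Ω + M < ⊤ := ENNReal.add_lt_top.2 ⟨hΩ.lt_top, hM.lt_top⟩
  have hscaled (c : ℝ) : Tendsto (fun n => modular Ω (P n) (c • G n)) atTop
      (𝓝 (modular Ω p (c • g))) := by
    have hc : ‖c‖ₑ ^ r ≠ ⊤ := ENNReal.rpow_ne_top_of_nonneg hr enorm_ne_top
    refine tendsto_modular hΩ hq₀ hqr hSr hP hPp (fun n => (hG n).const_smul c)
      (hlim.mono fun x hx => hx.const_smul c) (ENNReal.mul_ne_top hc hM) fun n => ?_
    simp_rw [Pi.smul_apply, enorm_smul, ENNReal.mul_rpow_of_nonneg _ _ hr]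
    rw [lintegral_const_mul' _ _ hc]
    gcongr
    exact hGM n
  have hg : modular Ω p g < ⊤ := by
    have hlim₁ := hscaled 1
    simp only [one_smul] at hlim₁
    exact (le_of_tendsto' hlim₁ hmod).trans_lt hfin
  have hp : ∀ᵐ x ∂volume.restrict Ω, 1 ≤ p x := by
    filter_upwards [hPp, ae_all_iff.2 fun n => (hP n).ae_ge_of_le hq] with x hx hPx
    exact ge_of_tendsto' hx hPx
  exact ⟨⟨aestronglyMeasurable_of_tendsto_ae atTop hG hlim, hg⟩,
    tendsto_luxNorm (fun n => (hP n).ae_ge_of_le hq) hp (fun n => (hmod n).trans_lt hfin) hg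
      fun γ _ => hscaled γ⁻¹⟩

end VariableExponentLimit

section Sobolev

theorem sobolevConj_pos {N : ℕ} {q : ℝ} (hq : 0 < q) (hqN : q < N) : 0 < sobolevConj N q :=
  div_pos (mul_pos (hq.trans hqN) hq) (sub_pos.2 hqN)

theorem lt_sobolevConj {N : ℕ} {q : ℝ} (hq : 0 < q) (hqN : q < N) : q < sobolevConj N q := by
  rw [sobolevConj, lt_div_iff₀ (sub_pos.2 hqN)]
  nlinarith

theorem support_enorm_rpow_subset {α F : Type*} [NormedAddCommGroup F] (f : α → F) {q : ℝ}
    (hq : 0 < q) : Function.support (fun x => ‖f x‖ₑ ^ q) ⊆ Function.support f := by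
  refine Function.support_subset_iff'.2 fun x hx => ?_
  rw [Function.notMem_support.1 hx, enorm_zero, ENNReal.zero_rpow_of_pos hq]

theorem lintegral_enorm_le_of_support_subset {α F : Type*} [MeasurableSpace α]
    [NormedAddCommGroup F] {μ : Measure α} {Ω : Set α} {f : α → F} {q : ℝ}
    (hf : Function.support f ⊆ Ω) (hq : 1 ≤ q) :
    ∫⁻ x, ‖f x‖ₑ ∂μ ≤ μ Ω + ∫⁻ x, ‖f x‖ₑ ^ q ∂μ := by
  have hsupp := (support_enorm_rpow_subset f zero_lt_one).trans hf
  calc ∫⁻ x, ‖f x‖ₑ ∂μ = ∫⁻ x in Ω, ‖f x‖ₑ ^ (1 : ℝ) ∂μ := by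
        rw [setLIntegral_eq_of_support_subset hsupp]
        simp only [ENNReal.rpow_one]
    _ ≤ μ Ω + ∫⁻ x in Ω, ‖f x‖ₑ ^ q ∂μ := by
        rw [← Measure.restrict_apply_univ]
        exact lintegral_rpow_le_measure_univ_add _ (Eventually.of_forall fun _ => zero_le_one)
          (Eventually.of_forall fun _ => hq)
    _ ≤ μ Ω + ∫⁻ x, ‖f x‖ₑ ^ q ∂μ := by
        gcongr
        exact Measure.restrict_le_self

open Module

variable {E F : Type*} [NormedAddCommGroup E] [NormedSpace ℝ E] [FiniteDimensional ℝ E]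
  [MeasurableSpace E] [BorelSpace E] [NormedAddCommGroup F] [NormedSpace ℝ F]
  [FiniteDimensional ℝ F] {q : ℝ}

theorem exists_lintegral_rpow_sobolevConj_le (μ : Measure E) [μ.IsAddHaarMeasure]
    (hq : 1 ≤ q) (hqE : q < finrank ℝ E) (D : ℝ≥0) :
    ∃ M : ℝ≥0, ∀ f : E → F, ContDiff ℝ 1 f → HasCompactSupport f →
      ∫⁻ x, ‖fderiv ℝ f x‖ₑ ^ q ∂μ ≤ D → ∫⁻ x, ‖f x‖ₑ ^ sobolevConj (finrank ℝ E) q ∂μ ≤ M := by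
  have hq₀ : 0 < q := zero_lt_one.trans_le hq
  have hE : (0 : ℝ) < finrank ℝ E := hq₀.trans hqE
  have hr : 0 < sobolevConj (finrank ℝ E) q := sobolevConj_pos hq₀ hqE
  have hconj : (sobolevConj (finrank ℝ E) q)⁻¹ = q⁻¹ - (finrank ℝ E : ℝ)⁻¹ := by
    rw [sobolevConj]
    field_simp
  generalize sobolevConj (finrank ℝ E) q = r at hr hconj ⊢
  lift q to ℝ≥0 using hq₀.le
  lift r to ℝ≥0 using hr.le
  refine ⟨(SNormLESNormFDerivOfEqConst F μ q * D ^ (q : ℝ)⁻¹) ^ (r : ℝ), fun f hf hs hD => ?_⟩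
  have hgns : eLpNorm f r μ ≤ SNormLESNormFDerivOfEqConst F μ q * eLpNorm (fderiv ℝ f) q μ :=
    eLpNorm_le_eLpNorm_fderiv_of_eq μ hf hs (mod_cast hq) (mod_cast hE) hconj
  have hfderiv : eLpNorm (fderiv ℝ f) q μ ≤ (D ^ (q : ℝ)⁻¹ : ℝ≥0) := by
    rw [ENNReal.coe_rpow_of_nonneg _ (inv_nonneg.2 hq₀.le), ENNReal.le_rpow_inv_iff hq₀,
      eLpNorm_nnreal_pow_eq_lintegral (NNReal.coe_pos.1 hq₀).ne']
    exact hD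
  rw [← eLpNorm_nnreal_pow_eq_lintegral (NNReal.coe_pos.1 hr).ne',
    ENNReal.coe_rpow_of_nonneg _ hr.le, ENNReal.coe_mul]
  gcongr
  exact hgns.trans (by gcongr)

theorem exists_subseq_tendsto_of_lintegral_fderiv_rpow_le {μ : Measure E} [μ.IsAddHaarMeasure]
    {Ω : Set E} (hΩ : Bornology.IsBounded Ω) (hq : 1 ≤ q) (hqE : q < finrank ℝ E) {φ : ℕ → E → F}
    (hφ : ∀ n, ContDiff ℝ 1 (φ n)) (hs : ∀ n, HasCompactSupport (φ n))
    (hφΩ : ∀ n, tsupport (φ n) ⊆ Ω) {D : ℝ≥0}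
    (hD : ∀ n, ∫⁻ x, ‖fderiv ℝ (φ n) x‖ₑ ^ q ∂μ ≤ D) :
    ∃ (s : ℕ → ℕ) (v : Lp F 1 (μ.restrict Ω)), StrictMono s ∧
      Tendsto (fun j => eLpNorm (φ (s j) - ⇑v) 1 (μ.restrict Ω)) atTop (𝓝 0) ∧
      ∀ᵐ x ∂μ.restrict Ω, Tendsto (fun j => φ (s j) x) atTop (𝓝 (v x)) := by
  have hμΩ : μ Ω ≠ ⊤ := hΩ.measure_lt_top.ne
  have : ProperSpace F := FiniteDimensional.proper ℝ F
  have hq₀ : 0 < q := zero_lt_one.trans_le hq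
  obtain ⟨M, hM⟩ := exists_lintegral_rpow_sobolevConj_le (F := F) μ hq hqE D
  lift μ Ω to ℝ≥0 using hμΩ with m hm
  refine exists_subseq_tendsto_of_lintegral_fderiv_le hΩ hφ hs (M := m + M) (D := m + D)
    (fun n => ?_) fun n => ?_
  · refine (lintegral_enorm_le_of_support_subset ((subset_tsupport _).trans (hφΩ n))
      (hq.trans (lt_sobolevConj hq₀ hqE).le)).trans ?_
    rw [← hm, ENNReal.coe_add]
    gcongr
    exact hM _ (hφ n) (hs n) (hD n)
  · refine (lintegral_enorm_le_of_support_subset ((support_fderiv_subset ℝ).trans (hφΩ n))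
      hq).trans ?_
    rw [← hm, ENNReal.coe_add]
    gcongr
    exact hD n

end Sobolev

section Test

variable {N : ℕ} {Ω : Set (Eu N)} {p : Eu N → ℝ} {q S : ℝ} {φ : Eu N → ℝ}

theorem enorm_gradient (φ : Eu N → ℝ) (x : Eu N) : ‖gradient φ x‖ₑ = ‖fderiv ℝ φ x‖ₑ := by
  rw [gradient, ← ofReal_norm, ← ofReal_norm, LinearIsometryEquiv.norm_map]

theorem support_gradient_subset (φ : Eu N → ℝ) : Function.support (gradient φ) ⊆ tsupport φ := by
  intro x hx
  refine support_fderiv_subset ℝ fun h => hx ?_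
  rw [gradient, h, map_zero]

theorem IsTest.contDiff_one (hφ : IsTest Ω φ) : ContDiff ℝ 1 φ :=
  hφ.1.of_le (by exact_mod_cast le_top)

theorem IsTest.memLpVar (hΩ : volume Ω ≠ ⊤) (hq : 0 ≤ q) (hp : IsBoundedExponent Ω q S p)
    (hφ : IsTest Ω φ) : MemLpVar Ω p φ :=
  .of_hasCompactSupport hΩ hq hp hφ.1.continuous hφ.2.1

theorem IsTest.memLpVar_gradient (hΩ : volume Ω ≠ ⊤) (hq : 0 ≤ q)
    (hp : IsBoundedExponent Ω q S p) (hφ : IsTest Ω φ) : MemLpVar Ω p (gradient φ) :=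
  .of_hasCompactSupport hΩ hq hp
    ((InnerProductSpace.toDual ℝ (Eu N)).symm.continuous.comp
      (hφ.contDiff_one.continuous_fderiv one_ne_zero))
    ((hφ.2.1.fderiv ℝ).comp_left (map_zero _))

theorem IsTest.lintegral_enorm_fderiv_rpow_le (hφ : IsTest Ω φ) (hq : 0 < q)
    (hqp : ∀ᵐ x ∂volume.restrict Ω, q ≤ p x) {C : ℝ} (hC : 0 < C)
    (h : modular Ω p (C⁻¹ • gradient φ) ≤ 1) :
    ∫⁻ x, ‖fderiv ℝ φ x‖ₑ ^ q ≤ ENNReal.ofReal C ^ q * (volume Ω + 1) := by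
  have hsupp := (support_enorm_rpow_subset (gradient φ) hq).trans
    ((support_gradient_subset φ).trans hφ.2.2)
  simp_rw [← enorm_gradient]
  rw [← setLIntegral_eq_of_support_subset hsupp]
  exact lintegral_rpow_le_of_modular_le_one hq.le hqp hC h

theorem MemW10.exists_isTest (hΩ : volume Ω ≠ ⊤) (hq : 1 ≤ q) (hp : IsBoundedExponent Ω q S p)
    {u : Eu N → ℝ} (hu : MemW10 Ω p u) {ε : ℝ} (hε : 0 < ε) :
    ∃ φ, IsTest Ω φ ∧ luxNorm Ω p (u - φ) < ε ∧
      luxNorm Ω p (gradient φ) < luxNorm Ω p (weakGrad Ω u) + ε := by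
  obtain ⟨⟨-, -, hgrad⟩, happrox⟩ := hu
  obtain ⟨φ, hφ, hlt⟩ := happrox ε hε
  have hu₀ : 0 ≤ luxNorm Ω p (u - φ) := luxNorm_nonneg
  have hgrad₀ : 0 ≤ luxNorm Ω p (weakGrad Ω u - gradient φ) := luxNorm_nonneg
  have hsum : luxNorm Ω p (u - φ) + luxNorm Ω p (weakGrad Ω u - gradient φ) < ε := hlt
  have htri : luxNorm Ω p (gradient φ) - luxNorm Ω p (weakGrad Ω u) ≤
      luxNorm Ω p (weakGrad Ω u - gradient φ) := by
    rw [luxNorm_sub_comm]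
    exact luxNorm_sub_luxNorm_le hq hp (hφ.memLpVar_gradient hΩ (zero_le_one.trans hq) hp) hgrad
  exact ⟨φ, hφ, by linarith, by linarith⟩

end Test

section Compactness

variable {N : ℕ} {Ω : Set (Eu N)} {q S : ℝ} {P : ℕ → Eu N → ℝ} {p : Eu N → ℝ}

theorem exists_subseq_tendsto_luxNorm_of_isTest (hΩ : Bornology.IsBounded Ω) (hq : 1 ≤ q)
    (hqN : q < N) (hS : S < sobolevConj N q) (hP : ∀ n, IsBoundedExponent Ω q S (P n))
    (hPp : ∀ᵐ x ∂volume.restrict Ω, Tendsto (fun n => P n x) atTop (𝓝 (p x)))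
    {φ : ℕ → Eu N → ℝ} (hφ : ∀ n, IsTest Ω (φ n)) {D : ℝ≥0}
    (hD : ∀ n, ∫⁻ x, ‖fderiv ℝ (φ n) x‖ₑ ^ q ≤ D) :
    ∃ (s : ℕ → ℕ) (v : L1 Ω), StrictMono s ∧
      Tendsto (fun j => eLpNorm (φ (s j) - ⇑v) 1 (volume.restrict Ω)) atTop (𝓝 0) ∧
      MemLpVar Ω p v ∧
      Tendsto (fun j => luxNorm Ω (P (s j)) (φ (s j))) atTop (𝓝 (luxNorm Ω p v)) := by
  have hfinrank : Module.finrank ℝ (Eu N) = N := finrank_euclideanSpace_fin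
  have hqN' : q < Module.finrank ℝ (Eu N) := by rwa [hfinrank]
  obtain ⟨M, hM⟩ := exists_lintegral_rpow_sobolevConj_le (F := ℝ) (volume : Measure (Eu N)) hq
    hqN' D
  rw [hfinrank] at hM
  obtain ⟨s, v, hs, hnorm, hae⟩ := exists_subseq_tendsto_of_lintegral_fderiv_rpow_le hΩ hq hqN'
    (fun n => (hφ n).contDiff_one) (fun n => (hφ n).2.1) (fun n => (hφ n).2.2) hD
  refine ⟨s, v, hs, hnorm, tendsto_luxNorm_of_lintegral_rpow_le hΩ.measure_lt_top.ne hq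
    (lt_sobolevConj (zero_lt_one.trans_le hq) hqN) hS (fun j => hP (s j))
    (hPp.mono fun x hx => hx.comp hs.tendsto_atTop)
    (fun j => (hφ (s j)).1.continuous.aestronglyMeasurable) hae (ENNReal.coe_ne_top (r := M))
    fun j => ?_⟩
  exact (setLIntegral_le_lintegral _ _).trans
    (hM _ (hφ (s j)).contDiff_one (hφ (s j)).2.1 (hD (s j)))

theorem eLpNorm_one_le_of_luxNorm_lt (hp : ∀ᵐ x ∂volume.restrict Ω, 1 ≤ p x) {f : Eu N → ℝ}
    (hf : MemLpVar Ω p f) {γ : ℝ} (h : luxNorm Ω p f < γ) :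
    eLpNorm f 1 (volume.restrict Ω) ≤ ENNReal.ofReal γ * (volume Ω + 1) := by
  simpa only [eLpNorm_one_eq_lintegral_enorm, ENNReal.rpow_one] using
    lintegral_rpow_le_of_modular_le_one zero_le_one hp (luxNorm_nonneg.trans_lt h)
      (modular_inv_smul_lt_one_of_luxNorm_lt hp hf.2 h).le

theorem exists_isTest_approx (hΩ : volume Ω ≠ ⊤) (hq : 1 ≤ q)
    (hP : ∀ n, IsBoundedExponent Ω q S (P n)) {u : ℕ → Eu N → ℝ} (hu : ∀ n, MemW10 Ω (P n) (u n))
    {C : ℝ} (huC : ∀ n, luxNorm Ω (P n) (weakGrad Ω (u n)) ≤ C) :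
    ∃ (φ : ℕ → Eu N → ℝ) (D : ℝ≥0), (∀ n, IsTest Ω (φ n)) ∧
      (∀ n, ∫⁻ x, ‖fderiv ℝ (φ n) x‖ₑ ^ q ≤ D) ∧
      Tendsto (fun n => luxNorm Ω (P n) (u n - φ n)) atTop (𝓝 0) ∧
      Tendsto (fun n => eLpNorm (u n - φ n) 1 (volume.restrict Ω)) atTop (𝓝 0) := by
  have hq₀ : 0 < q := zero_lt_one.trans_le hq
  have hP₁ (n : ℕ) := (hP n).ae_ge_of_le hq
  choose φ hφ hlux hgrad using fun n =>
    (hu n).exists_isTest hΩ hq (hP n) (Nat.one_div_pos_of_nat (α := ℝ) (n := n))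
  have hε₁ (n : ℕ) : 1 / ((n : ℝ) + 1) ≤ 1 := div_le_one_of_le₀ (by simp) (by positivity)
  have hD (n : ℕ) : ∫⁻ x, ‖fderiv ℝ (φ n) x‖ₑ ^ q ≤
      ENNReal.ofReal (C + 1) ^ q * (volume Ω + 1) := by
    have hlt : luxNorm Ω (P n) (gradient (φ n)) < C + 1 :=
      (hgrad n).trans_le (by grw [huC n, hε₁ n])
    exact (hφ n).lintegral_enorm_fderiv_rpow_le hq₀ (hP n).ae_ge (luxNorm_nonneg.trans_lt hlt)
      (modular_inv_smul_lt_one_of_luxNorm_lt (hP₁ n)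
        ((hφ n).memLpVar_gradient hΩ hq₀.le (hP n)).2 hlt).le
  have hD_ne_top : ENNReal.ofReal (C + 1) ^ q * (volume Ω + 1) ≠ ⊤ :=
    ENNReal.mul_ne_top (ENNReal.rpow_ne_top_of_nonneg hq₀.le ENNReal.ofReal_ne_top)
      (ENNReal.add_ne_top.2 ⟨hΩ, ENNReal.one_ne_top⟩)
  have hε : Tendsto (fun n : ℕ => 1 / ((n : ℝ) + 1)) atTop (𝓝 0) :=
    tendsto_one_div_add_atTop_nhds_zero_nat
  have hεΩ : Tendsto (fun n : ℕ => ENNReal.ofReal (1 / ((n : ℝ) + 1)) * (volume Ω + 1)) atTop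
      (𝓝 0) := by
    simpa using ENNReal.Tendsto.mul_const (ENNReal.tendsto_ofReal hε)
      (Or.inr (ENNReal.add_ne_top.2 ⟨hΩ, ENNReal.one_ne_top⟩))
  refine ⟨φ, _, hφ, fun n => (hD n).trans_eq (ENNReal.coe_toNNReal hD_ne_top).symm,
    squeeze_zero (fun n => luxNorm_nonneg) (fun n => (hlux n).le) hε,
    tendsto_of_tendsto_of_tendsto_of_le_of_le tendsto_const_nhds hεΩ (fun n => zero_le)
      fun n => eLpNorm_one_le_of_luxNorm_lt (hP₁ n) ?_ (hlux n)⟩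
  exact (hu n).1.1.sub hq (hP n) ((hφ n).memLpVar hΩ hq₀.le (hP n))

theorem exists_subseq_tendsto_luxNorm (hΩ : Bornology.IsBounded Ω) (hq : 1 ≤ q) (hqN : q < N)
    (hS : S < sobolevConj N q) (hP : ∀ n, IsBoundedExponent Ω q S (P n))
    (hPp : ∀ᵐ x ∂volume.restrict Ω, Tendsto (fun n => P n x) atTop (𝓝 (p x)))
    {u : ℕ → L1 Ω} (hu : ∀ n, MemW10 Ω (P n) (u n)) {C : ℝ}
    (huC : ∀ n, luxNorm Ω (P n) (weakGrad Ω (u n)) ≤ C) :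
    ∃ (s : ℕ → ℕ) (v : L1 Ω), StrictMono s ∧ Tendsto (fun j => u (s j)) atTop (𝓝 v) ∧
      MemLpVar Ω p v ∧
      Tendsto (fun j => luxNorm Ω (P (s j)) (u (s j))) atTop (𝓝 (luxNorm Ω p v)) := by
  have hμΩ : volume Ω ≠ ⊤ := hΩ.measure_lt_top.ne
  obtain ⟨φ, D, hφ, hD, huφ, huφ₁⟩ := exists_isTest_approx hμΩ hq hP hu huC
  obtain ⟨s, v, hs, hφv, hv, hlux⟩ :=
    exists_subseq_tendsto_luxNorm_of_isTest hΩ hq hqN hS hP hPp hφ hD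
  refine ⟨s, v, hs, ?_, hv, ?_⟩
  · have hsum := (huφ₁.comp hs.tendsto_atTop).add hφv
    rw [add_zero] at hsum
    refine (Lp.tendsto_Lp_iff_tendsto_eLpNorm' _ _).2
      (tendsto_of_tendsto_of_tendsto_of_le_of_le tendsto_const_nhds hsum (fun j => zero_le)
        fun j => ?_)
    have hφm : AEStronglyMeasurable (φ (s j)) (volume.restrict Ω) :=
      (hφ (s j)).1.continuous.aestronglyMeasurable
    rw [← sub_add_sub_cancel (u (s j) : Eu N → ℝ) (φ (s j)) v]
    exact eLpNorm_add_le ((Lp.aestronglyMeasurable _).sub hφm)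
      (hφm.sub (Lp.aestronglyMeasurable _)) le_rfl
  · have hdiff : Tendsto (fun j => luxNorm Ω (P (s j)) (u (s j)) - luxNorm Ω (P (s j)) (φ (s j)))
        atTop (𝓝 0) :=
      squeeze_zero_norm (fun j => abs_luxNorm_sub_luxNorm_le hq (hP _) (hu _).1.1
        ((hφ _).memLpVar hμΩ (zero_le_one.trans hq) (hP _))) (huφ.comp hs.tendsto_atTop)
    simpa only [sub_add_cancel, zero_add] using hdiff.add hlux

end Compactness

section Exponents

variable {N : ℕ} {Ω : Set (Eu N)} {p : Eu N → ℝ}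

theorem Admissible.isCompact_image (hp : Admissible Ω p) (hΩ : Bornology.IsBounded Ω) :
    IsCompact (p '' closure Ω) :=
  hΩ.isCompact_closure.image_of_continuousOn hp.continuousOn

theorem Admissible.expInf_le (hp : Admissible Ω p) (hΩ : Bornology.IsBounded Ω) {x : Eu N}
    (hx : x ∈ Ω) : expInf Ω p ≤ p x :=
  csInf_le ((hp.isCompact_image hΩ).bddBelow.mono (image_mono subset_closure))
    (mem_image_of_mem _ hx)

theorem Admissible.le_expSup (hp : Admissible Ω p) (hΩ : Bornology.IsBounded Ω) {x : Eu N}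
    (hx : x ∈ Ω) : p x ≤ expSup Ω p :=
  le_csSup ((hp.isCompact_image hΩ).bddAbove.mono (image_mono subset_closure))
    (mem_image_of_mem _ hx)

theorem Admissible.expInf_lt_dim (hp : Admissible Ω p) (hΩ : Bornology.IsBounded Ω)
    (hne : Ω.Nonempty) : expInf Ω p < N :=
  let ⟨_, hx⟩ := hne
  ((hp.expInf_le hΩ hx).trans (hp.le_expSup hΩ hx)).trans_lt hp.lt_dim

theorem Admissible.isBoundedExponent (hp : Admissible Ω p) (hΩ : Bornology.IsBounded Ω)
    (hm : MeasurableSet Ω) {q S : ℝ} (hq : q ≤ expInf Ω p) (hS : expSup Ω p ≤ S) :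
    IsBoundedExponent Ω q S p where
  aemeasurable := (hp.continuousOn.mono subset_closure).aemeasurable hm
  ae_ge := ae_restrict_of_forall_mem hm fun _ hx => hq.trans (hp.expInf_le hΩ hx)
  ae_le := ae_restrict_of_forall_mem hm fun _ hx => (hp.le_expSup hΩ hx).trans hS

variable {ph : ℕ → Eu N → ℝ} {hbar h : ℕ}

theorem tailInf_le_expInf (hph : ∀ h, Admissible Ω (ph h)) (hh : hbar ≤ h) :
    tailInf Ω ph hbar ≤ expInf Ω (ph h) :=
  csInf_le ⟨1, forall_mem_image.2 fun h _ => (hph h).one_lt.le⟩ (mem_image_of_mem _ hh)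

theorem expSup_le_tailSup (hph : ∀ h, Admissible Ω (ph h)) (hh : hbar ≤ h) :
    expSup Ω (ph h) ≤ tailSup Ω ph hbar :=
  le_csSup ⟨N, forall_mem_image.2 fun h _ => (hph h).lt_dim.le⟩ (mem_image_of_mem _ hh)

theorem tailInf_lt_dim (hph : ∀ h, Admissible Ω (ph h)) (hΩ : Bornology.IsBounded Ω)
    (hne : Ω.Nonempty) : tailInf Ω ph hbar < N :=
  (tailInf_le_expInf hph le_rfl).trans_lt ((hph hbar).expInf_lt_dim hΩ hne)

theorem isBoundedExponent_tail (hph : ∀ h, Admissible Ω (ph h)) (hΩ : Bornology.IsBounded Ω)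
    (hm : MeasurableSet Ω) (hh : hbar ≤ h) :
    IsBoundedExponent Ω (tailInf Ω ph hbar) (tailSup Ω ph hbar) (ph h) :=
  (hph h).isBoundedExponent hΩ hm (tailInf_le_expInf hph hh) (expSup_le_tailSup hph hh)

end Exponents

section Functionals

variable {N : ℕ} {Ω : Set (Eu N)} {p : Eu N → ℝ} {u : L1 Ω}

theorem MemW10.of_energy_lt_top (h : energy Ω p u < ⊤) : MemW10 Ω p u := by
  by_contra hu
  exact h.ne (if_neg hu)

theorem MemW10.energy_eq (hu : MemW10 Ω p u) :
    energy Ω p u = ENNReal.ofReal (luxNorm Ω p (weakGrad Ω u)) :=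
  if_pos hu

theorem MemLpVar.gNorm_eq (hu : MemLpVar Ω p u) : gNorm Ω p u = luxNorm Ω p u := if_pos hu

end Functionals

end VarExp

open VarExp in
theorem theorem2p10_general {N : ℕ} {Ω : Set (Eu N)} (hΩ : Bornology.IsBounded Ω)
    {P : ℕ → Eu N → ℝ} {p : Eu N → ℝ} {q S : ℝ} (hq : 1 ≤ q) (hqN : q < N)
    (hS : S < sobolevConj N q) (hP : ∀ᶠ n in atTop, IsBoundedExponent Ω q S (P n))
    (hPp : ∀ᵐ x ∂volume.restrict Ω, Tendsto (fun n => P n x) atTop (𝓝 (p x)))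
    {u : ℕ → L1 Ω} (hu : (⨆ n, energy Ω (P n) (u n)) < ⊤) :
    ∃ (s : ℕ → ℕ) (v : L1 Ω), StrictMono s ∧
      Tendsto (fun j => u (s j)) atTop (𝓝 v) ∧
      MemLpVar Ω p v ∧
      Tendsto (fun j => gNorm Ω (P (s j)) (u (s j))) atTop (𝓝 (gNorm Ω p v)) := by
  have hle (n : ℕ) : energy Ω (P n) (u n) ≤ ⨆ n, energy Ω (P n) (u n) :=
    le_iSup (fun n => energy Ω (P n) (u n)) n
  have hmem (n : ℕ) : MemW10 Ω (P n) (u n) := .of_energy_lt_top ((hle n).trans_lt hu)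
  have hnorm (n : ℕ) : luxNorm Ω (P n) (weakGrad Ω (u n)) ≤
      (⨆ n, energy Ω (P n) (u n)).toReal :=
    (ENNReal.ofReal_le_iff_le_toReal hu.ne).1 ((hmem n).energy_eq ▸ hle n)
  obtain ⟨n₀, hn₀⟩ := eventually_atTop.1 hP
  obtain ⟨s, v, hs, hlim, hv, hlux⟩ := exists_subseq_tendsto_luxNorm hΩ hq hqN hS
    (P := fun n => P (n + n₀)) (fun n => hn₀ _ (Nat.le_add_left _ _))
    (hPp.mono fun x hx => hx.comp (tendsto_add_atTop_nat n₀))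
    (u := fun n => u (n + n₀)) (fun n => hmem _) (fun n => hnorm _)
  refine ⟨fun j => s j + n₀, v, hs.add_const n₀, hlim, hv, ?_⟩
  simpa only [hv.gNorm_eq, (hmem _).1.1.gNorm_eq] using hlux

theorem theorem2p10 {N : ℕ} (hN : 2 ≤ N) (Ω : Set (VarExp.Eu N))
    (hΩ : VarExp.IsBoundedLipschitzDomain Ω)
    (p : VarExp.Eu N → ℝ) (hp : VarExp.Admissible Ω p)
    (ph : ℕ → VarExp.Eu N → ℝ) (hph : ∀ h, VarExp.Admissible Ω (ph h))
    (hconv : ∀ x ∈ Ω, Tendsto (fun h => ph h x) atTop (𝓝 (p x)))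
    (hbar : ℕ)
    (hlow : 1 < VarExp.tailInf Ω ph hbar)
    (hup : VarExp.tailSup Ω ph hbar < VarExp.sobolevConj N (VarExp.tailInf Ω ph hbar))
    (k : ℕ → ℕ) (hk : StrictMono k)
    (u : ℕ → VarExp.L1 Ω)
    (hbdd : (⨆ n, VarExp.energy Ω (ph (k n)) (u n)) < ⊤) :
    ∃ (s : ℕ → ℕ) (v : VarExp.L1 Ω), StrictMono s ∧
      Tendsto (fun j => u (s j)) atTop (𝓝 v) ∧
      VarExp.MemLpVar Ω p v ∧
      Tendsto (fun j => VarExp.gNorm Ω (ph (k (s j))) (u (s j))) atTop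
        (𝓝 (VarExp.gNorm Ω p v)) := by
  have hm : MeasurableSet Ω := hΩ.isOpen.measurableSet
  exact theorem2p10_general hΩ.isBounded hlow.le
    (VarExp.tailInf_lt_dim hph hΩ.isBounded hΩ.isConnected.nonempty) hup
    ((hk.tendsto_atTop.eventually_ge_atTop hbar).mono fun _ hn =>
      VarExp.isBoundedExponent_tail hph hΩ.isBounded hm hn)
    (ae_restrict_of_forall_mem hm fun x hx => (hconv x hx).comp hk.tendsto_atTop) hbdd
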